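/- For positive integers $n,d$ with $d<n$, a *sparse anti-magic square* $\mathrm{SAMS}(n,d)$ is an $n\times n$ array with entries in $\{0,1,\dots,nd\}$ such that each element of $\{1,\dots,nd\}$ occurs in exactly one cell and the set of all row sums, column sums and the two main diagonal sums consists of $2n+2$ consecutive integers. It is *regular* if every row, every column and each of the two main diagonals contains exactly $d$ positive entries. Let $n\ge 5$ be an integer with $n\equiv 1$ or $5\pmod 6$, and let $d$ be a nonnegative integer. Then a regular $\mathrm{SAMS}(n,d)$ exists if and only if $2\le d\le n-1$. (Since the definition requires $1\le d<n$, no $\mathrm{SAMS}(n,d)$ exists for $d=0$ or $d\ge n$.) -/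

import Mathlib

/-- The sum along the left diagonal (upper left to lower right) of an `n × n` array. -/
def leftDiagSum {n : ℕ} (A : Matrix (Fin n) (Fin n) ℕ) : ℕ := ∑ i, A i i

/-- The sum along the right diagonal (upper right to lower left) of an `n × n` array. -/
def rightDiagSum {n : ℕ} (A : Matrix (Fin n) (Fin n) ℕ) : ℕ := ∑ i, A i i.rev

/-- The sum set of an array: the set of all row sums, column sums and the two main
diagonal sums. -/
def sumSet {n : ℕ} (A : Matrix (Fin n) (Fin n) ℕ) : Set ℕ :=
  Set.range (fun i => ∑ j, A i j) ∪ Set.range (fun j => ∑ i, A i j) ∪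
    {leftDiagSum A, rightDiagSum A}

/-- `A` is a sparse anti-magic square of order `n` with density `d`, an `SAMS(n,d)`. -/
structure IsSAMS (n d : ℕ) (A : Matrix (Fin n) (Fin n) ℕ) : Prop where
  order_pos : 0 < n
  density_pos : 0 < d
  density_lt : d < n
  /-- The entries lie in `{0, 1, …, nd}`. -/
  entry_le : ∀ i j, A i j ≤ n * d
  /-- Each of `1, …, nd` occurs in exactly one cell. -/
  occurs_once : ∀ v ∈ Set.Icc 1 (n * d), ∃! c : Fin n × Fin n, A c.1 c.2 = v
  /-- The sum set consists of `2n + 2` consecutive integers. -/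
  sumSet_eq : ∃ a : ℕ, sumSet A = Set.Icc a (a + 2 * n + 1)

/-- `A` is a regular `SAMS(n,d)`: every row, every column and both main diagonals contain
exactly `d` positive entries. -/
structure IsRegularSAMS (n d : ℕ) (A : Matrix (Fin n) (Fin n) ℕ) : Prop
    extends IsSAMS n d A where
  row_card : ∀ i, (Finset.univ.filter fun j => 0 < A i j).card = d
  col_card : ∀ j, (Finset.univ.filter fun i => 0 < A i j).card = d
  leftDiag_card : (Finset.univ.filter fun i => 0 < A i i).card = d
  rightDiag_card : (Finset.univ.filter fun i : Fin n => 0 < A i i.rev).card = d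

/-!
# Regular sparse anti-magic squares of order prime to `6`

For `d = 1` every line sum is a single entry, hence at most `n`, and `2n + 2` different sums are
impossible (`two_le_of_isRegularSAMS`).

For `d ≥ 2`, let `n` be prime to `6`. The cells `(i, j)` of a broken line `j = 2i + c` modulo `n`
form a transversal that meets each row, each column and both main diagonals exactly once, because
`1`, `2` and `3` are units modulo `n`. So any `d` of these transversals, filled bijectively with
`1, …, nd`, give a regular array, and only the line sums matter. Taking consecutive transversals
and labelling rows and columns suitably, the cell of transversal `k` in row `x` lies in column
`x + k`, and the diagonals meet it in the rows `P - 2k` and `Q - 2k/3`, where `P` and `Q` are at our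
disposal. This is the notion `HasFilling`, and `exists_isRegularSAMS_of_hasFilling` turns a filling
into a square. As there are only `2n + 2` lines, it suffices that every number of the window is the
sum of some line.

Fillings come by induction on `d` in steps of three. A Kotzig array, three permutations of
`0, …, n - 1` with constant sum, can be put on three further transversals so that all row sums and
all column sums of the new part are the same; a rotation of the array that remains free makes both
diagonals agree with them (`HasFilling.add_three`). This shifts all line sums by a constant.

The base cases are `d = 2, 3, 4` (`hasFilling_two`, `hasFilling_three`, `hasFilling_four`). There
the permutations on the transversals are piecewise linear, and the deviations of the line sums from
their mean are `-n, …, n + 1`. The rows and columns account for all of these but `0` and `n + 1`,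
which are the deviations of the two diagonals once `P` and `Q` are chosen. A few cases
with `n = 5` and `n = 7` are settled by tables.
-/

/-! ### From fillings to squares -/

/-- Residues modulo `n` are enumerated by the naturals below `n`. -/
lemma ZMod.sum_eq_sum_range {n : ℕ} [NeZero n] (F : ZMod n → ℕ) :
    ∑ κ, F κ = ∑ k ∈ Finset.range n, F k := by
  refine Finset.sum_nbij' (fun κ => κ.val) (fun k => (k : ZMod n)) ?_ ?_ ?_ ?_ ?_
  · intro κ _
    exact Finset.mem_range.2 κ.val_lt
  · simp
  · intro κ _
    simp
  · intro k hk
    exact ZMod.val_cast_of_lt (Finset.mem_range.1 hk)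
  · intro κ _
    simp

/-- A filling of `d` transversals. The transversal with offset `k` has one cell in each row
`x : ZMod n`, and that cell lies in column `x + k`; it holds the value `e k x`. All values are
different and fill `0, …, nd - 1`, and each of the `2n + 2` numbers of the window starting at `a` is
a row sum, a column sum, or a sum along one of two lines that meet the transversals `k` in the rows
`P - 2k` and `Q - tk`, where `t = 2/3` modulo `n`. These lines are the diagonals of the square; how
rows and columns are labelled decides what `P` and `Q` are, and any two values are possible. -/
def HasFilling (n d : ℕ) : Prop :=
  ∃ (e : ℕ → ZMod n → ℕ) (P Q t : ZMod n) (a : ℕ), 3 * t = 2 ∧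
    (∀ k < d, ∀ x, e k x < n * d) ∧
    (∀ k < d, ∀ l < d, ∀ x y, e k x = e l y → k = l ∧ x = y) ∧
    ∀ v ∈ Finset.Icc a (a + 2 * n + 1),
      (∃ x, ∑ k ∈ Finset.range d, e k x = v) ∨
      (∃ y : ZMod n, ∑ k ∈ Finset.range d, e k (y - k) = v) ∨
      ∑ k ∈ Finset.range d, e k (P - 2 * k) = v ∨
      ∑ k ∈ Finset.range d, e k (Q - t * k) = v

/-- The entry in row `x` of the transversal with offset `κ`; the cells of the transversals
`d, …, n - 1` are empty. The values of a filling start at `0`, the entries at `1`. -/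
def transversalCell {n : ℕ} (d : ℕ) (e : ℕ → ZMod n → ℕ) (κ x : ZMod n) : ℕ :=
  if κ.val < d then e κ.val x + 1 else 0

lemma sum_range_ite_lt {n d : ℕ} (h : d ≤ n) (G : ℕ → ℕ) :
    ∑ k ∈ Finset.range n, (if k < d then G k else 0) = ∑ k ∈ Finset.range d, G k := by
  rw [← Finset.sum_filter]
  congr 1
  ext k
  simp only [Finset.mem_filter, Finset.mem_range]
  omega

section Line

variable {n d : ℕ} [NeZero n] {e : ℕ → ZMod n → ℕ} {ψ : Fin n → ZMod n}

/-- A line that meets each of the `n` transversals once has `d` nonempty cells, whose sum is read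
off the filling. -/
lemma sum_transversalCell (hd : d ≤ n) (hψ : ψ.Bijective) (g : ZMod n → ZMod n) :
    ∑ i, transversalCell d e (ψ i) (g (ψ i)) = ∑ k ∈ Finset.range d, e k (g k) + d := by
  rw [hψ.sum_comp (fun κ => transversalCell d e κ (g κ)), ZMod.sum_eq_sum_range]
  have : ∀ k ∈ Finset.range n, transversalCell d e (k : ZMod n) (g k) =
      if k < d then e k (g k) + 1 else 0 := by
    intro k hk
    rw [transversalCell, ZMod.val_cast_of_lt (Finset.mem_range.1 hk)]
  rw [Finset.sum_congr rfl this, sum_range_ite_lt hd (fun k => e k (g k) + 1),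
    Finset.sum_add_distrib]
  simp

lemma card_transversalCell_pos (hd : d ≤ n) (hψ : ψ.Bijective) (g : ZMod n → ZMod n) :
    (Finset.univ.filter fun i => 0 < transversalCell d e (ψ i) (g (ψ i))).card = d := by
  rw [Finset.card_filter,
    hψ.sum_comp (fun κ => if 0 < transversalCell d e κ (g κ) then 1 else 0),
    ZMod.sum_eq_sum_range]
  have : ∀ k ∈ Finset.range n, (if 0 < transversalCell d e (k : ZMod n) (g k) then 1 else 0) =
      if k < d then 1 else 0 := by
    intro k hk
    rw [transversalCell, ZMod.val_cast_of_lt (Finset.mem_range.1 hk)]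
    split_ifs <;> simp_all
  rw [Finset.sum_congr rfl this, sum_range_ite_lt hd (fun _ => 1)]
  simp

end Line

lemma sumSet_eq_range {n : ℕ} (A : Matrix (Fin n) (Fin n) ℕ) :
    sumSet A = Set.range (Sum.elim (fun i => ∑ j, A i j)
      (Sum.elim (fun j => ∑ i, A i j)
        (fun b : Bool => if b then leftDiagSum A else rightDiagSum A))) := by
  ext v
  simp only [sumSet, Set.Sum.elim_range, Set.mem_union, Set.mem_insert_iff,
    Set.mem_singleton_iff, Set.mem_range, Bool.exists_bool]
  simp only [Bool.false_eq_true, if_true, if_false, or_assoc, eq_comm (a := v)]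
  tauto

/-- There are only `2n + 2` lines, so once every value of the window is a line sum, no other
line sum can occur. -/
lemma sumSet_eq_of_subset {n : ℕ} {A : Matrix (Fin n) (Fin n) ℕ} {a : ℕ}
    (h : Set.Icc a (a + 2 * n + 1) ⊆ sumSet A) : sumSet A = Set.Icc a (a + 2 * n + 1) := by
  rw [sumSet_eq_range] at h ⊢
  refine (Set.eq_of_subset_of_ncard_le h ?_ (Set.finite_range _)).symm
  rw [← Set.image_univ]
  refine (Set.ncard_image_le Set.finite_univ).trans ?_
  rw [Set.ncard_univ, ← Finset.coe_Icc, Set.ncard_coe_finset, Nat.card_Icc]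
  simp [Nat.card_eq_fintype_card]
  omega

lemma natCast_fin_bijective (n : ℕ) [NeZero n] :
    Function.Bijective (fun i : Fin n => ((i : ℕ) : ZMod n)) := by
  rw [Fintype.bijective_iff_injective_and_card]
  refine ⟨fun i j h => ?_, by simp [ZMod.card]⟩
  have := congrArg ZMod.val h
  simp only [ZMod.val_cast_of_lt i.2, ZMod.val_cast_of_lt j.2] at this
  exact Fin.ext this

lemma natCast_fin_rev {n : ℕ} (i : Fin n) : ((i.rev : ℕ) : ZMod n) = -1 - (i : ℕ) := by
  have h : (i.rev : ℕ) + i + 1 = n := by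
    have := i.2
    rw [Fin.val_rev]
    omega
  have h' := congrArg (Nat.cast : ℕ → ZMod n) h
  push_cast at h'
  rw [ZMod.natCast_self] at h'
  linear_combination h'

lemma exists_value_of_injective {n d : ℕ} [NeZero n] {e : ℕ → ZMod n → ℕ}
    (hlt : ∀ k < d, ∀ x, e k x < n * d)
    (hinj : ∀ k < d, ∀ l < d, ∀ x y, e k x = e l y → k = l ∧ x = y) {v : ℕ} (hv : v < n * d) :
    ∃ k < d, ∃ x, e k x = v := by
  let f : Fin d × ZMod n → Fin (n * d) := fun p => ⟨e p.1 p.2, hlt p.1 p.1.2 p.2⟩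
  have hf : Function.Bijective f := by
    rw [Fintype.bijective_iff_injective_and_card]
    refine ⟨?_, by simp [ZMod.card, mul_comm]⟩
    rintro ⟨k, x⟩ ⟨l, y⟩ h
    obtain ⟨h₁, h₂⟩ := hinj k k.2 l l.2 x y (congrArg Fin.val h)
    exact Prod.ext (Fin.ext h₁) h₂
  obtain ⟨⟨k, x⟩, h⟩ := hf.2 ⟨v, hv⟩
  exact ⟨k, k.2, x, congrArg Fin.val h⟩

/-- Column `j` gets the label `y` with `j = 2 (y - σ) + ℓ`, where row `i` has the label `i + σ`. So
each transversal is a broken line of slope `2`, and meets every row, every column and,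
as `n` is prime to `6`, both diagonals exactly once. That `3` is invertible is contained in the
existence of `t` in `HasFilling`. -/
theorem exists_isRegularSAMS_of_hasFilling {n d : ℕ} (hn : 0 < n) (hodd : Nat.Coprime n 2)
    (hd : 0 < d) (hdn : d < n) (F : HasFilling n d) :
    ∃ A : Matrix (Fin n) (Fin n) ℕ, IsRegularSAMS n d A := by
  have : NeZero n := ⟨hn.ne'⟩
  obtain ⟨e, P, Q, t, a, ht, hlt, hinj, hwin⟩ := F
  obtain ⟨s, hs⟩ : ∃ s : ZMod n, 2 * s = 1 :=
    ⟨(2 : ZMod n)⁻¹, by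
      have := ZMod.coe_mul_inv_eq_one (n := n) 2 hodd.symm
      exact_mod_cast this⟩
  have hw : 3 * (t * s) = 1 := by linear_combination s * ht + hs
  -- `ℓ` and `σ` place the filling so that the two diagonals meet the transversal of offset `κ`
  -- in the rows labelled `P - 2κ` and `Q - tκ`.
  obtain ⟨ℓ, hℓ⟩ : ∃ ℓ : ZMod n, Q + t * s * (1 + ℓ) = P + ℓ :=
    ⟨(Q - P + t * s) * (3 * s), by
      linear_combination (Q - P + t * s) * (s * hw - hs)⟩
  set σ := P + ℓ with hσ
  let φ : Fin n → ZMod n := fun i => ((i : ℕ) : ZMod n)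
  have hφ : Function.Bijective φ := natCast_fin_bijective n
  let A : Matrix (Fin n) (Fin n) ℕ :=
    fun i j => transversalCell d e (s * (φ j - ℓ) - φ i) (φ i + σ)
  have hrow (i : Fin n) : Function.Bijective (fun j => s * (φ j - ℓ) - φ i) := by
    refine Function.Bijective.comp (g := fun z => s * (z - ℓ) - φ i) ?_ hφ
    refine Finite.injective_iff_bijective.1 fun x y h => ?_
    linear_combination 2 * h + (y - x) * hs
  have hcol (j : Fin n) : Function.Bijective (fun i => s * (φ j - ℓ) - φ i) := by
    refine Function.Bijective.comp (g := fun z => s * (φ j - ℓ) - z) ?_ hφ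
    refine Finite.injective_iff_bijective.1 fun x y h => ?_
    linear_combination -h
  have hleft : Function.Bijective (fun i => s * (φ i - ℓ) - φ i) := by
    refine Function.Bijective.comp (g := fun z => s * (z - ℓ) - z) ?_ hφ
    refine Finite.injective_iff_bijective.1 fun x y h => ?_
    linear_combination -2 * h + (x - y) * hs
  have hright : Function.Bijective (fun i => s * (-1 - φ i - ℓ) - φ i) := by
    refine Function.Bijective.comp (g := fun z => s * (-1 - z - ℓ) - z) ?_ hφ
    refine Finite.injective_iff_bijective.1 fun x y h => ?_
    linear_combination (-t) * h + (y - x) * (hw - t * hs)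
  have hA_row (i : Fin n) : (fun j => A i j) = fun j => transversalCell d e
      (s * (φ j - ℓ) - φ i) ((fun _ => φ i + σ) (s * (φ j - ℓ) - φ i)) := rfl
  have hA_col (j : Fin n) : (fun i => A i j) = fun i => transversalCell d e
      (s * (φ j - ℓ) - φ i) ((fun κ => (s * (φ j - ℓ) + σ) - κ) (s * (φ j - ℓ) - φ i)) := by
    funext i
    simp only [A]
    congr 1
    ring
  have hA_left : (fun i => A i i) = fun i => transversalCell d e
      (s * (φ i - ℓ) - φ i) ((fun κ => P - 2 * κ) (s * (φ i - ℓ) - φ i)) := by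
    funext i
    simp only [A]
    congr 1
    linear_combination (φ i - ℓ) * hs + hσ
  have hA_right : (fun i : Fin n => A i i.rev) = fun i => transversalCell d e
      (s * (-1 - φ i - ℓ) - φ i) ((fun κ => Q - t * κ) (s * (-1 - φ i - ℓ) - φ i)) := by
    funext i
    simp only [A, φ, natCast_fin_rev]
    congr 1
    linear_combination hσ - hℓ - (i : ZMod n) * (hw - t * hs)
  have hsum_row (i : Fin n) :
      ∑ j, A i j = ∑ k ∈ Finset.range d, e k (φ i + σ) + d := by
    rw [hA_row i]
    exact sum_transversalCell (e := e) hdn.le (hrow i) (fun _ => φ i + σ)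
  have hsum_col (j : Fin n) :
      ∑ i, A i j = ∑ k ∈ Finset.range d, e k ((s * (φ j - ℓ) + σ) - k) + d := by
    rw [hA_col j]
    exact sum_transversalCell (e := e) hdn.le (hcol j) (fun κ => (s * (φ j - ℓ) + σ) - κ)
  have hsum_left : ∑ i, A i i = ∑ k ∈ Finset.range d, e k (P - 2 * k) + d := by
    rw [hA_left]
    exact sum_transversalCell (e := e) hdn.le hleft (fun κ => P - 2 * κ)
  have hsum_right :
      ∑ i : Fin n, A i i.rev = ∑ k ∈ Finset.range d, e k (Q - t * k) + d := by
    rw [hA_right]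
    exact sum_transversalCell (e := e) hdn.le hright (fun κ => Q - t * κ)
  refine ⟨A, ⟨hn, hd, hdn, ?_, ?_, a + d, sumSet_eq_of_subset ?_⟩, ?_, ?_, ?_, ?_⟩
  · intro i j
    simp only [A, transversalCell]
    split_ifs with h
    · exact hlt _ h _
    · exact Nat.zero_le _
  · intro v hv
    obtain ⟨hv₁, hv₂⟩ := hv
    obtain ⟨k, hk, x, hx⟩ := exists_value_of_injective hlt hinj (v := v - 1) (by omega)
    obtain ⟨i, hi⟩ := hφ.2 (x - σ)
    obtain ⟨j, hj⟩ := (hrow i).2 (k : ZMod n)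
    have hkval : (k : ZMod n).val = k := ZMod.val_cast_of_lt (hk.trans hdn)
    refine ⟨(i, j), ?_, ?_⟩
    · simp only [A, transversalCell] at hj ⊢
      rw [hj, hkval, if_pos hk, hi, sub_add_cancel, hx]
      omega
    · rintro ⟨i', j'⟩ h
      simp only [A, transversalCell] at h
      split_ifs at h with h'
      · obtain ⟨h₁, h₂⟩ := hinj _ h' k hk (φ i' + σ) x (by omega)
        have hi' : i' = i := hφ.1 (by rw [hi, ← h₂, add_sub_cancel_right])
        subst hi'
        refine Prod.ext rfl ((hrow i').1 ?_)
        simp only at hj ⊢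
        rw [hj, ← h₁, ZMod.natCast_zmod_val]
      · omega
  · rintro v ⟨hv₁, hv₂⟩
    rcases hwin (v - d) (Finset.mem_Icc.2 ⟨by omega, by omega⟩) with ⟨x, h⟩ | ⟨y, h⟩ | h | h
    · obtain ⟨i, hi⟩ := hφ.2 (x - σ)
      refine Or.inl (Or.inl ⟨i, ?_⟩)
      simp only [hsum_row, hi, sub_add_cancel, h]
      omega
    · obtain ⟨j, hj⟩ := hφ.2 (2 * (y - σ) + ℓ)
      refine Or.inl (Or.inr ⟨j, ?_⟩)
      have : s * (φ j - ℓ) + σ = y := by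
        rw [hj]
        linear_combination (y - σ) * hs
      simp only [hsum_col, this, h]
      omega
    · refine Or.inr (Or.inl ?_)
      simp only [leftDiagSum, hsum_left, h]
      omega
    · refine Or.inr (Or.inr ?_)
      simp only [Set.mem_singleton_iff, rightDiagSum, hsum_right, h]
      omega
  · intro i
    simpa only [← hA_row i] using card_transversalCell_pos (e := e) hdn.le (hrow i)
      (fun _ => φ i + σ)
  · intro j
    simpa only [congrFun (hA_col j)] using
      card_transversalCell_pos (e := e) hdn.le (hcol j) (fun κ => (s * (φ j - ℓ) + σ) - κ)
  · simpa only [congrFun hA_left] using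
      card_transversalCell_pos (e := e) hdn.le hleft (fun κ => P - 2 * κ)
  · simpa only [congrFun hA_right] using
      card_transversalCell_pos (e := e) hdn.le hright (fun κ => Q - t * κ)

/-! ### Necessity -/

/-- For `d = 1` every line sum is a single entry, so at most `n`: the window does not fit. -/
theorem two_le_of_isRegularSAMS {n d : ℕ} {A : Matrix (Fin n) (Fin n) ℕ}
    (hA : IsRegularSAMS n d A) : 2 ≤ d := by
  by_contra! hd
  have hd1 : d = 1 := by
    have := hA.density_pos
    omega
  subst hd1
  have key : ∀ f : Fin n → ℕ, (∀ i, f i ≤ n) → (Finset.univ.filter fun i => 0 < f i).card = 1 →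
      ∑ i, f i ≤ n := by
    intro f hf hc
    obtain ⟨i, hi⟩ := Finset.card_eq_one.1 hc
    rw [Finset.sum_eq_single i]
    · exact hf i
    · intro j _ hj
      by_contra h
      exact hj (Finset.mem_singleton.1 (hi ▸ Finset.mem_filter.2
        ⟨Finset.mem_univ j, Nat.pos_of_ne_zero h⟩))
    · simp
  have hle : ∀ i j, A i j ≤ n := fun i j => by simpa using hA.entry_le i j
  obtain ⟨a, ha⟩ := hA.sumSet_eq
  have hmem : a + 2 * n + 1 ∈ sumSet A := by
    rw [ha]
    exact ⟨by omega, le_rfl⟩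
  have : a + 2 * n + 1 ≤ n := by
    rcases hmem with (⟨i, hi⟩ | ⟨j, hj⟩) | h | h
    · exact hi ▸ key _ (hle i) (hA.row_card i)
    · exact hj ▸ key _ (fun i => hle i j) (hA.col_card j)
    · exact h ▸ key _ (fun i => hle i i) hA.leftDiag_card
    · exact h ▸ key _ (fun i => hle i i.rev) hA.rightDiag_card
  omega

/-! ### Adding three transversals with constant line sums -/

lemma ZMod.val_add_cases {n : ℕ} [NeZero n] (x y : ZMod n) :
    (x + y).val = x.val + y.val ∨ (x + y).val + n = x.val + y.val := by
  rcases lt_or_ge (x.val + y.val) n with h | h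
  · exact Or.inl (ZMod.val_add_of_lt h)
  · exact Or.inr (ZMod.val_add_val_of_le h).symm

/-- The permutation `w ↦ w + h` modulo `2h + 1`. Together with the identity and `kotzigC` it forms
a Kotzig array: three permutations of `0, …, 2h` with constant sum `3h`. -/
def kotzigB (h w : ℕ) : ℕ := if w ≤ h then w + h else w - h - 1

/-- The permutation `w ↦ -2w - 1` modulo `2h + 1`; see `kotzigB`. -/
def kotzigC (h w : ℕ) : ℕ := if w ≤ h then 2 * h - 2 * w else 4 * h + 1 - 2 * w

lemma kotzig_row {h w : ℕ} (hw : w < 2 * h + 1) : w + kotzigC h w + kotzigB h w = 3 * h := by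
  unfold kotzigB kotzigC
  split_ifs <;> omega

section

variable {h : ℕ} [NeZero (2 * h + 1)]

/-- A column meets the three permutations at the shifts `w`, `w + 1/2` and `w + 1`. The sum is still
constant, since `w + 1 = z - h` for `z = w + 1/2`, so that the identity and `kotzigB` have just
changed places. -/
lemma kotzig_col {s : ZMod (2 * h + 1)} (hs : s.val = h + 1) (w : ZMod (2 * h + 1)) :
    w.val + kotzigC h (w + s).val + kotzigB h (w + 1).val = 3 * h := by
  have h1 : (1 : ZMod (2 * h + 1)).val = 1 % (2 * h + 1) := ZMod.val_one_eq_one_mod _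
  rcases Nat.eq_zero_or_pos h with rfl | hh
  · have := s.val_lt
    omega
  rw [Nat.mod_eq_of_lt (by omega)] at h1
  have hw := w.val_lt
  have hw1 := (w + s).val_lt
  have hw2 := (w + 1).val_lt
  have c1 := ZMod.val_add_cases w s
  have c2 := ZMod.val_add_cases w 1
  rw [hs] at c1
  rw [h1] at c2
  generalize w.val = a at *
  generalize (w + s).val = b at *
  generalize (w + 1).val = c at *
  unfold kotzigB kotzigC
  split_ifs <;> omega

/-- The residues `w` for which the diagonal meeting the three permutations at `w`, `w + 1` and
`w + 2` is sure to have the sum `3h`. The others are `h - 1`, `h`, `2h - 1` and `2h`. -/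
def KotzigDiagGood (h w : ℕ) : Prop :=
  w + 2 ≤ h ∨ h + 1 ≤ w ∧ w + 2 ≤ 2 * h

lemma kotzig_diag (hh : 1 ≤ h) (w : ZMod (2 * h + 1)) (hw : KotzigDiagGood h w.val) :
    w.val + kotzigC h (w + 1).val + kotzigB h (w + 2).val = 3 * h := by
  have h1 : (1 : ZMod (2 * h + 1)).val = 1 % (2 * h + 1) := ZMod.val_one_eq_one_mod _
  rw [Nat.mod_eq_of_lt (by omega)] at h1
  have h2 : (2 : ZMod (2 * h + 1)).val = 2 := by
    exact_mod_cast ZMod.val_cast_of_lt (n := 2 * h + 1) (a := 2) (by omega)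
  have hw1 := (w + 1).val_lt
  have hw2 := (w + 2).val_lt
  have c1 := ZMod.val_add_cases w 1
  have c2 := ZMod.val_add_cases w 2
  rw [h1] at c1
  rw [h2] at c2
  unfold KotzigDiagGood at hw
  generalize w.val = a at *
  generalize (w + 1).val = b at *
  generalize (w + 2).val = c at *
  unfold kotzigB kotzigC
  split_ifs <;> omega

/-- The antidiagonal meets the three permutations at `w`, `w + c` and `w + 2c`, where `c = 1/3`
modulo `2h + 1`. For `w + c` in a suitable half of the residues, which depends on `h` modulo `3`,
the sum is `3h`. -/
lemma kotzig_antidiag {m z₀ : ℕ} {c : ZMod (2 * h + 1)}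
    (hc : h = 3 * m ∧ c.val = 4 * m + 1 ∧ z₀ = 0 ∨
      h = 3 * m + 2 ∧ c.val = 2 * m + 2 ∧ z₀ = h + 1)
    (w : ZMod (2 * h + 1)) (hw : z₀ ≤ (w + c).val ∧ (w + c).val < z₀ + h) :
    w.val + kotzigC h (w + c).val + kotzigB h (w + c + c).val = 3 * h := by
  have hw0 := w.val_lt
  have hw1 := (w + c).val_lt
  have hw2 := (w + c + c).val_lt
  have c1 := ZMod.val_add_cases w c
  have c2 := ZMod.val_add_cases (w + c) c
  generalize w.val = a at *
  generalize (w + c + c).val = b at *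
  generalize (w + c).val = z at *
  generalize c.val = u at *
  unfold kotzigB kotzigC
  rcases hc with ⟨rfl, rfl, rfl⟩ | ⟨rfl, rfl, rfl⟩ <;> split_ifs <;> omega

/-- A rotation that suits both diagonals: of two residues that differ by `2`, at least one is good
for the diagonal, since the bad ones are two pairs of neighbours. -/
lemma exists_kotzig_shift (hh : 4 ≤ h) {z₀ : ℕ} (hz₀ : z₀ ≤ h + 1) (Δ : ZMod (2 * h + 1)) :
    ∃ w z : ZMod (2 * h + 1), z = w + Δ ∧ KotzigDiagGood h w.val ∧
      z₀ ≤ z.val ∧ z.val < z₀ + h := by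
  have h2 : (2 : ZMod (2 * h + 1)).val = 2 := by
    exact_mod_cast ZMod.val_cast_of_lt (n := 2 * h + 1) (a := 2) (by omega)
  have hz : (z₀ : ZMod (2 * h + 1)).val = z₀ := ZMod.val_cast_of_lt (by omega)
  have hz2 : ((z₀ + 2 : ℕ) : ZMod (2 * h + 1)).val = z₀ + 2 := ZMod.val_cast_of_lt (by omega)
  have hlt := ((z₀ : ZMod (2 * h + 1)) - Δ).val_lt
  have hlt2 := ((z₀ : ZMod (2 * h + 1)) - Δ + 2).val_lt
  have hc := ZMod.val_add_cases ((z₀ : ZMod (2 * h + 1)) - Δ) 2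
  rw [h2] at hc
  by_cases hg : KotzigDiagGood h ((z₀ : ZMod (2 * h + 1)) - Δ).val
  · exact ⟨z₀ - Δ, z₀, by ring, hg, by omega, by omega⟩
  · refine ⟨z₀ - Δ + 2, ((z₀ + 2 : ℕ) : ZMod (2 * h + 1)), by push_cast; ring, ?_,
      by omega, by omega⟩
    unfold KotzigDiagGood at hg ⊢
    omega

end

lemma kotzigB_lt {h w : ℕ} (hw : w < 2 * h + 1) : kotzigB h w < 2 * h + 1 := by
  unfold kotzigB
  split_ifs <;> omega

lemma kotzigC_lt {h w : ℕ} (hw : w < 2 * h + 1) : kotzigC h w < 2 * h + 1 := by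
  unfold kotzigC
  split_ifs <;> omega

lemma kotzigB_inj {h v w : ℕ} (hv : v < 2 * h + 1) (hw : w < 2 * h + 1)
    (he : kotzigB h v = kotzigB h w) : v = w := by
  unfold kotzigB at he
  split_ifs at he <;> omega

lemma kotzigC_inj {h v w : ℕ} (hv : v < 2 * h + 1) (hw : w < 2 * h + 1)
    (he : kotzigC h v = kotzigC h w) : v = w := by
  unfold kotzigC at he
  split_ifs at he <;> omega

/-- The filling `e` with `d` transversals, enlarged by three transversals that hold the next `3n`
values, where `n = 2h + 1`: the Kotzig array of the identity, `kotzigC` and `kotzigB`, read at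
`ρ - s * x` in row `x`. For `s = 1/2` all row and column sums of the three new transversals agree;
the rotation `ρ` is free. -/
def kotzigExtension {h : ℕ} (d : ℕ) (s ρ : ZMod (2 * h + 1))
    (e : ℕ → ZMod (2 * h + 1) → ℕ) (k : ℕ) (x : ZMod (2 * h + 1)) : ℕ :=
  if k < d then e k x
  else if k = d then (2 * h + 1) * d + (ρ - s * x).val
  else if k = d + 1 then (2 * h + 1) * d + (2 * h + 1) + kotzigC h (ρ - s * x).val
  else (2 * h + 1) * d + 2 * (2 * h + 1) + kotzigB h (ρ - s * x).val

lemma sum_kotzigExtension {h d : ℕ} {s ρ : ZMod (2 * h + 1)}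
    {e : ℕ → ZMod (2 * h + 1) → ℕ} (g : ℕ → ZMod (2 * h + 1)) {w₀ w₁ w₂ : ZMod (2 * h + 1)}
    (hw₀ : ρ - s * g d = w₀) (hw₁ : ρ - s * g (d + 1) = w₁) (hw₂ : ρ - s * g (d + 2) = w₂)
    (hw : w₀.val + kotzigC h w₁.val + kotzigB h w₂.val = 3 * h) :
    ∑ k ∈ Finset.range (d + 3), kotzigExtension d s ρ e k (g k) =
      ∑ k ∈ Finset.range d, e k (g k) + (3 * ((2 * h + 1) * (d + 1)) + 3 * h) := by
  rw [Finset.sum_range_succ, Finset.sum_range_succ, Finset.sum_range_succ]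
  have : ∑ k ∈ Finset.range d, kotzigExtension d s ρ e k (g k) =
      ∑ k ∈ Finset.range d, e k (g k) :=
    Finset.sum_congr rfl fun k hk => if_pos (Finset.mem_range.1 hk)
  rw [this]
  have h0 : kotzigExtension d s ρ e d (g d) = (2 * h + 1) * d + (ρ - s * g d).val := by
    simp [kotzigExtension]
  have h1 : kotzigExtension d s ρ e (d + 1) (g (d + 1)) =
      (2 * h + 1) * d + (2 * h + 1) + kotzigC h (ρ - s * g (d + 1)).val := by
    simp [kotzigExtension]
  have h2 : kotzigExtension d s ρ e (d + 2) (g (d + 2)) =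
      (2 * h + 1) * d + 2 * (2 * h + 1) + kotzigB h (ρ - s * g (d + 2)).val := by
    simp [kotzigExtension]
  rw [h0, h1, h2, hw₀, hw₁, hw₂, mul_add (2 * h + 1) d 1]
  omega

/-- With a suitable rotation the three new transversals add the same amount to every line,
so the window is only translated. -/
theorem HasFilling.add_three {n d m : ℕ} (hn : 9 ≤ n)
    (hm : n = 6 * m + 1 ∨ n = 6 * m + 5) (F : HasFilling n d) : HasFilling n (d + 3) := by
  obtain ⟨h, rfl⟩ : ∃ h, n = 2 * h + 1 := ⟨n / 2, by omega⟩
  obtain ⟨e, P, Q, t, a, ht, hlt, hinj, hwin⟩ := F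
  have hself : ((2 * h + 1 : ℕ) : ZMod (2 * h + 1)) = 0 := ZMod.natCast_self _
  obtain ⟨s, hs, hsval⟩ : ∃ s : ZMod (2 * h + 1), 2 * s = 1 ∧ s.val = h + 1 :=
    ⟨((h + 1 : ℕ) : ZMod (2 * h + 1)), by
      push_cast at hself ⊢
      linear_combination hself, ZMod.val_cast_of_lt (by omega)⟩
  have hc3 : 3 * (t * s) = 1 := by linear_combination s * ht + hs
  obtain ⟨z₀, hz₀, hc⟩ : ∃ z₀, z₀ ≤ h + 1 ∧ (h = 3 * m ∧ (t * s).val = 4 * m + 1 ∧ z₀ = 0 ∨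
      h = 3 * m + 2 ∧ (t * s).val = 2 * m + 2 ∧ z₀ = h + 1) := by
    rcases hm with hm | hm
    · refine ⟨0, by omega, Or.inl ⟨by omega, ?_, rfl⟩⟩
      have hh : h = 3 * m := by omega
      subst hh
      have : t * s = ((4 * m + 1 : ℕ) : ZMod (2 * (3 * m) + 1)) := by
        push_cast at hself ⊢
        linear_combination (4 * (m : ZMod (2 * (3 * m) + 1)) + 1) * hc3 - 2 * (t * s) * hself
      rw [this]
      exact ZMod.val_cast_of_lt (by omega)
    · refine ⟨h + 1, by omega, Or.inr ⟨by omega, ?_, rfl⟩⟩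
      have hh : h = 3 * m + 2 := by omega
      subst hh
      have : t * s = ((2 * m + 2 : ℕ) : ZMod (2 * (3 * m + 2) + 1)) := by
        push_cast at hself ⊢
        linear_combination
          (2 * (m : ZMod (2 * (3 * m + 2) + 1)) + 2) * hc3 - (t * s) * hself
      rw [this]
      exact ZMod.val_cast_of_lt (by omega)
  obtain ⟨w, z, hzw, hw, hz⟩ := exists_kotzig_shift (h := h) (by omega) hz₀
    (s * (P - 2 * d) - s * (Q - t * d) + t * s)
  set ρ := w + s * (P - 2 * d) with hρ
  have hlt' (x : ZMod (2 * h + 1)) : x.val < 2 * h + 1 := x.val_lt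
  have hsx : ∀ x y : ZMod (2 * h + 1), (ρ - s * x).val = (ρ - s * y).val → x = y := by
    intro x y hxy
    have := ZMod.val_injective _ hxy
    linear_combination (-2) * this + (y - x) * hs
  refine ⟨kotzigExtension d s ρ e, P, Q, t, a + (3 * ((2 * h + 1) * (d + 1)) + 3 * h), ht,
    ?_, ?_, ?_⟩
  · intro k hk x
    have h1 := hlt' (ρ - s * x)
    have h2 := kotzigC_lt h1
    have h3 := kotzigB_lt h1
    rw [mul_add (2 * h + 1) d 3]
    unfold kotzigExtension
    split_ifs with h4
    · have := hlt k h4 x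
      omega
    all_goals omega
  · intro k hk l hl x y hxy
    have hx1 := hlt' (ρ - s * x)
    have hx2 := kotzigC_lt hx1
    have hx3 := kotzigB_lt hx1
    have hy1 := hlt' (ρ - s * y)
    have hy2 := kotzigC_lt hy1
    have hy3 := kotzigB_lt hy1
    have hB := kotzigB_inj hx1 hy1
    have hC := kotzigC_inj hx1 hy1
    have hkx := fun hk' => hlt k hk' x
    have hly := fun hl' => hlt l hl' y
    unfold kotzigExtension at hxy
    split_ifs at hxy with h1 h2 h2 h2 h3 h2 h3 h4 h5
    all_goals first
      | exact hinj k h1 l h2 x y hxy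
      | (have := hkx (by assumption); omega)
      | (have := hly (by assumption); omega)
      | exact ⟨by omega, hsx x y (by omega)⟩
  · intro v hv
    rw [Finset.mem_Icc] at hv
    rcases hwin (v - (3 * ((2 * h + 1) * (d + 1)) + 3 * h))
      (Finset.mem_Icc.2 ⟨by omega, by omega⟩) with ⟨x, hx⟩ | ⟨y, hy⟩ | hD | hD
    · refine Or.inl ⟨x, ?_⟩
      rw [sum_kotzigExtension (fun _ => x) rfl rfl rfl (kotzig_row (hlt' _)), hx]
      omega
    · refine Or.inr (Or.inl ⟨y, ?_⟩)
      rw [sum_kotzigExtension (fun k : ℕ => y - (k : ZMod (2 * h + 1))) rfl ?_ ?_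
        (kotzig_col hsval _), hy]
      · omega
      · push_cast
        ring
      · push_cast
        linear_combination hs
    · refine Or.inr (Or.inr (Or.inl ?_))
      rw [sum_kotzigExtension (fun k : ℕ => P - 2 * (k : ZMod (2 * h + 1))) ?_ ?_ ?_
        (kotzig_diag (by omega) w hw), hD]
      · omega
      · rw [hρ]
        ring
      · rw [hρ]
        push_cast
        linear_combination hs
      · rw [hρ]
        push_cast
        linear_combination 2 * hs
    · refine Or.inr (Or.inr (Or.inr ?_))
      have hz' : ρ - s * (Q - t * d) + t * s = z := by
        rw [hzw, hρ]
        ring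
      rw [sum_kotzigExtension (fun k : ℕ => Q - t * (k : ZMod (2 * h + 1))) rfl ?_ ?_
        (kotzig_antidiag hc (ρ - s * (Q - t * d)) (by rw [hz']; exact hz)), hD]
      · omega
      · push_cast
        ring
      · push_cast
        ring

/-! ### Fillings by natural-number formulas, and small orders -/

/-- A filling given by functions of the representatives `0, …, n - 1` of the rows. A line is
given by the rows `p k` in which it meets the transversals. -/
lemma hasFilling_of_nat {n d : ℕ} [NeZero n] (f : Fin d → ℕ → ℕ) (P Q t a : ℕ)
    (ht : 3 * t ≡ 2 [MOD n])
    (hlt : ∀ k, ∀ j < n, f k j < n * d)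
    (hinj : ∀ k l, ∀ i < n, ∀ j < n, f k i = f l j → k = l ∧ i = j)
    (hwin : ∀ v, a ≤ v → v ≤ a + 2 * n + 1 → ∃ p : Fin d → ℕ, ∑ k, f k (p k) = v ∧
      (∀ k, p k < n) ∧
      ((∃ x, ∀ k, p k = x) ∨ (∃ y, ∀ k, p k + k ≡ y [MOD n]) ∨
        (∀ k, p k + 2 * k ≡ P [MOD n]) ∨ ∀ k, p k + t * k ≡ Q [MOD n])) :
    HasFilling n d := by
  have hsum (p : Fin d → ℕ) (hp : ∀ k, p k < n) (g : ℕ → ZMod n)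
      (hg : ∀ k : Fin d, g k = (p k : ZMod n)) :
      ∑ k ∈ Finset.range d, (fun k (x : ZMod n) => if h : k < d then f ⟨k, h⟩ x.val else 0) k (g k)
        = ∑ k, f k (p k) := by
    rw [Finset.sum_range]
    refine Finset.sum_congr rfl fun k _ => ?_
    simp only [k.2, dif_pos, Fin.eta, hg k, ZMod.val_cast_of_lt (hp k)]
  refine ⟨fun k x => if h : k < d then f ⟨k, h⟩ x.val else 0, P, Q, t, a, ?_, ?_, ?_, ?_⟩
  · exact_mod_cast (ZMod.natCast_eq_natCast_iff _ _ _).2 ht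
  · intro k hk x
    simp only [hk, dif_pos]
    exact hlt _ _ x.val_lt
  · intro k hk l hl x y h
    simp only [hk, hl, dif_pos] at h
    obtain ⟨h₁, h₂⟩ := hinj _ _ _ x.val_lt _ y.val_lt h
    exact ⟨congrArg Fin.val h₁, ZMod.val_injective n h₂⟩
  · intro v hv
    rw [Finset.mem_Icc] at hv
    obtain ⟨p, hv, hp, ⟨x, h⟩ | ⟨y, h⟩ | h | h⟩ := hwin v hv.1 hv.2
    · refine Or.inl ⟨(x : ZMod n), ?_⟩
      rw [← hv]
      exact hsum p hp (fun _ => x) fun k => by rw [h k]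
    all_goals have h' := fun k => (ZMod.natCast_eq_natCast_iff _ _ _).2 (h k)
    · refine Or.inr (Or.inl ⟨(y : ZMod n), ?_⟩)
      rw [← hv]
      refine hsum p hp (fun k => (y : ZMod n) - k) fun k => ?_
      rw [← h' k]
      push_cast
      ring
    · refine Or.inr (Or.inr (Or.inl ?_))
      rw [← hv]
      refine hsum p hp (fun k => (P : ZMod n) - 2 * k) fun k => ?_
      rw [← h' k]
      push_cast
      ring
    · refine Or.inr (Or.inr (Or.inr ?_))
      rw [← hv]
      refine hsum p hp (fun k => (Q : ZMod n) - t * k) fun k => ?_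
      rw [← h' k]
      push_cast
      ring

/-- The hypotheses of `hasFilling_of_nat` in a form that a finite computation can check. -/
lemma hasFilling_of_finite_check {n d : ℕ} [NeZero n] (f : Fin d → ℕ → ℕ) (P Q t a : ℕ)
    (ht : 3 * t % n = 2 % n)
    (hlt : ∀ k, ∀ j < n, f k j < n * d)
    (hinj : ∀ k l, ∀ i < n, ∀ j < n, f k i = f l j → k = l ∧ i = j)
    (hwin : ∀ i < 2 * n + 2,
      (∃ x < n, ∑ k, f k x = a + i) ∨
      (∃ y < n, ∑ k : Fin d, f k ((y + (n - 1) * k) % n) = a + i) ∨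
      ∑ k : Fin d, f k ((P + (n - 1) * (2 * k)) % n) = a + i ∨
      ∑ k : Fin d, f k ((Q + (n - 1) * (t * k)) % n) = a + i) :
    HasFilling n d := by
  have hn : 0 < n := Nat.pos_of_ne_zero (NeZero.ne n)
  have hmod (y c : ℕ) : (y + (n - 1) * c) % n + c ≡ y [MOD n] := by
    have h : y + (n - 1) * c + c = y + n * c := by
      obtain ⟨m, rfl⟩ : ∃ m, n = m + 1 := ⟨n - 1, by omega⟩
      rw [Nat.add_sub_cancel]
      ring
    calc (y + (n - 1) * c) % n + c ≡ y + (n - 1) * c + c [MOD n] :=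
          (Nat.mod_modEq _ _).add_right c
      _ = y + n * c := h
      _ ≡ y [MOD n] := by simp [Nat.ModEq]
  refine hasFilling_of_nat f P Q t a ht hlt hinj fun v hv hv' => ?_
  rcases hwin (v - a) (by omega) with ⟨x, hx, h⟩ | ⟨y, -, h⟩ | h | h
  · exact ⟨fun _ => x, h.trans (by omega), fun _ => hx, Or.inl ⟨x, fun _ => rfl⟩⟩
  · exact ⟨_, h.trans (by omega), fun _ => Nat.mod_lt _ hn,
      Or.inr (Or.inl ⟨y, fun k => hmod y k⟩)⟩
  · exact ⟨_, h.trans (by omega), fun _ => Nat.mod_lt _ hn,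
      Or.inr (Or.inr (Or.inl fun k => hmod P (2 * k)))⟩
  · exact ⟨_, h.trans (by omega), fun _ => Nat.mod_lt _ hn,
      Or.inr (Or.inr (Or.inr fun k => hmod Q (t * k)))⟩

/-- The filling whose `k`-th transversal holds the values `nk, …, nk + n - 1`, in the order given
by the linear map `x ↦ u k * x + v k` modulo `n`. -/
def linearFilling (n : ℕ) {d : ℕ} (u v : Fin d → ℕ) (k : Fin d) (x : ℕ) : ℕ :=
  k * n + (u k * x + v k) % n

lemma hasFilling_five_three : HasFilling 5 3 :=
  hasFilling_of_finite_check
    (fun k x => (![![7, 0, 3, 4, 1], ![5, 10, 8, 13, 9], ![14, 12, 6, 2, 11]] :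
      Fin 3 → Fin 5 → ℕ) k (Fin.ofNat 5 x)) 3 0 4 16
    (by decide) (by decide) (by decide +kernel) (by decide +kernel)

lemma hasFilling_five_four : HasFilling 5 4 :=
  hasFilling_of_finite_check (linearFilling 5 ![2, 3, 2, 4] ![0, 0, 0, 3]) 3 2 4 33
    (by decide) (by decide) (by decide +kernel) (by decide +kernel)

lemma hasFilling_seven_three : HasFilling 7 3 :=
  hasFilling_of_finite_check (linearFilling 7 ![3, 6, 1] ![0, 6, 4]) 0 3 3 22
    (by decide) (by decide) (by decide +kernel) (by decide +kernel)

lemma hasFilling_seven_four : HasFilling 7 4 :=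
  hasFilling_of_finite_check (linearFilling 7 ![5, 1, 1, 1] ![0, 2, 1, 3]) 4 4 3 47
    (by decide) (by decide) (by decide +kernel) (by decide +kernel)

lemma hasFilling_seven_five : HasFilling 7 5 :=
  hasFilling_of_finite_check (linearFilling 7 ![4, 3, 6, 6, 5] ![0, 4, 6, 0, 3]) 1 2 3 77
    (by decide) (by decide +kernel) (by decide +kernel) (by decide +kernel)

lemma hasFilling_seven_six : HasFilling 7 6 :=
  hasFilling_of_finite_check (linearFilling 7 ![4, 4, 4, 5, 5, 2] ![0, 2, 3, 2, 2, 4]) 0 0 3 115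
    (by decide) (by decide +kernel) (by decide +kernel) (by decide +kernel)

/-! ### Shared lemmas for the base cases -/

lemma modEq_of_eq_add_mul {n a b : ℕ} (r : ℕ) (h : a = b + n * r) : a ≡ b [MOD n] := by
  subst h
  simp [Nat.ModEq]

/-- A congruence modulo a variable `n` in a form that linear arithmetic can decide. -/
lemma modEq_of_eq_or {n a b : ℕ}
    (h : a = b ∨ a = b + n ∨ a = b + 2 * n ∨ a = b + 3 * n) : a ≡ b [MOD n] := by
  rcases h with h | h | h | h
  · exact modEq_of_eq_add_mul 0 (by omega)
  · exact modEq_of_eq_add_mul 1 (by omega)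
  · exact modEq_of_eq_add_mul 2 (by omega)
  · exact modEq_of_eq_add_mul 3 (by omega)

/-- `2/3` modulo `n`, when `n` is prime to `6`. -/
lemma exists_two_thirds {n m : ℕ} (hm : n = 6 * m + 1 ∨ n = 6 * m + 5) :
    ∃ t, 3 * t ≡ 2 [MOD n] ∧
      (n = 6 * m + 1 ∧ t = 2 * m + 1 ∨ n = 6 * m + 5 ∧ t = 4 * m + 4) := by
  rcases hm with hm | hm
  · exact ⟨2 * m + 1, modEq_of_eq_or (by omega), Or.inl ⟨hm, rfl⟩⟩
  · exact ⟨4 * m + 4, modEq_of_eq_or (by omega), Or.inr ⟨hm, rfl⟩⟩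

/-! ### Two transversals -/

/-- The first of the two transversals of the filling for `d = 2`, where `n = 2h + 1`. The numbers
`0, …, 4h + 1` label the edges of the `2n`-cycle of rows and columns; both label sequences run
downwards by one, in a low and a high half, so that the sums of consecutive rows, or of consecutive
columns, differ by two. Up to a few exceptions the row sums are even and the column sums odd. -/
def lowTwo (h x : ℕ) : ℕ :=
  if x < h then h - 1 - x else if x < 2 * h then 3 * h - 1 - x else 3 * h

/-- The second transversal of the filling for `d = 2`; see `lowTwo`. -/
def highTwo (h x : ℕ) : ℕ := if x < h then 3 * h - 1 - x else 5 * h + 1 - x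

/-- `v` is a row sum or a column sum of the filling for `d = 2`. -/
def IsLineSumTwo (h v : ℕ) : Prop :=
  ∃ i j, i < 2 * h + 1 ∧ j < 2 * h + 1 ∧ lowTwo h i + highTwo h j = v ∧
    (i = j ∨ i = j + 1 ∨ i + (2 * h + 1) = j + 1)

/-- Rows and columns realize every sum in the window but two: the mean `4h + 1`, and the
maximum `6h + 3`. These are left to the diagonals. -/
lemma isLineSumTwo {h v : ℕ} (hh : 2 ≤ h) (hv : 2 * h ≤ v) (hv' : v ≤ 6 * h + 3)
    (h0 : v ≠ 4 * h + 1) (h1 : v ≠ 6 * h + 3) : IsLineSumTwo h v := by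
  have row : ∀ i, i < 2 * h + 1 → lowTwo h i + highTwo h i = v → IsLineSumTwo h v :=
    fun i hi hv => ⟨i, i, hi, hi, hv, Or.inl rfl⟩
  have col : ∀ i, i < 2 * h → lowTwo h (i + 1) + highTwo h i = v → IsLineSumTwo h v :=
    fun i hi hv => ⟨i + 1, i, by omega, by omega, hv, Or.inr (Or.inl rfl)⟩
  unfold lowTwo highTwo at row col
  obtain ⟨r, hr | hr⟩ := Nat.even_or_odd' (v - 2 * h)
  · rcases (by omega : r < h ∨ r = h ∨ (h < r ∧ r ≤ 2 * h) ∨ r = 2 * h + 1) with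
      hc | hc | hc | hc
    · exact row (h - 1 - r) (by omega) (by split_ifs <;> omega)
    · refine ⟨0, 2 * h, by omega, by omega, ?_, by omega⟩
      unfold lowTwo highTwo
      split_ifs <;> omega
    · exact row (3 * h - r) (by omega) (by split_ifs <;> omega)
    · exact col (2 * h - 1) (by omega) (by split_ifs <;> omega)
  · rcases (by omega : r + 2 ≤ h ∨ r + 1 = h ∨ (h < r ∧ r < 2 * h) ∨ r = 2 * h) with
      hc | hc | hc | hc
    · exact col (h - 2 - r) (by omega) (by split_ifs <;> omega)
    · exact col (h - 1) (by omega) (by split_ifs <;> omega)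
    · exact col (3 * h - r - 1) (by omega) (by split_ifs <;> omega)
    · exact row (2 * h) (by omega) (by split_ifs <;> omega)

/-- An antidiagonal can be placed so that its sum is the mean `4h + 1`. -/
lemma exists_antidiag_two {h m t : ℕ} (hh : 2 ≤ h)
    (hmt : 2 * h + 1 = 6 * m + 1 ∧ t = 2 * m + 1 ∨ 2 * h + 1 = 6 * m + 5 ∧ t = 4 * m + 4) :
    ∃ i j, i < 2 * h + 1 ∧ j < 2 * h + 1 ∧ lowTwo h i + highTwo h j = 4 * h + 1 ∧
      (j + t = i ∨ j + t = i + (2 * h + 1)) := by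
  unfold lowTwo highTwo
  rcases hmt with ⟨h₁, rfl⟩ | ⟨h₁, rfl⟩
  · refine ⟨4 * m - 1, 2 * m - 2, by omega, by omega, ?_, by omega⟩
    split_ifs <;> omega
  · refine ⟨2 * m + 1, 4 * m + 2, by omega, by omega, ?_, by omega⟩
    split_ifs <;> omega

theorem hasFilling_two {n m : ℕ} (hn : 5 ≤ n) (hm : n = 6 * m + 1 ∨ n = 6 * m + 5) :
    HasFilling n 2 := by
  obtain ⟨h, rfl⟩ : ∃ h, n = 2 * h + 1 := ⟨n / 2, by omega⟩
  obtain ⟨t, ht, hmt⟩ := exists_two_thirds hm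
  obtain ⟨Q, j₀, hQ, hj₀, hsumQ, hQj⟩ := exists_antidiag_two (by omega) hmt
  refine hasFilling_of_nat ![lowTwo h, highTwo h] (2 * h) Q t (2 * h) ht
    (Fin.forall_fin_two.2 ⟨?_, ?_⟩) ?_ ?_
  · intro i hi
    simp only [Matrix.cons_val, lowTwo]
    split_ifs <;> omega
  · intro i hi
    simp only [Matrix.cons_val, highTwo]
    split_ifs <;> omega
  · intro k l i hi j hj hij
    fin_cases k <;> fin_cases l <;>
      simp [lowTwo, highTwo] at hij ⊢ <;> split_ifs at hij <;> omega
  · intro v hv hv'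
    have sum_eq (i j : ℕ) : ∑ k, (![lowTwo h, highTwo h] : Fin 2 → ℕ → ℕ) k
        ((![i, j] : Fin 2 → ℕ) k) = lowTwo h i + highTwo h j := by
      simp [Fin.sum_univ_two]
    by_cases h0 : v = 4 * h + 1
    · refine ⟨![Q, j₀], by rw [sum_eq, h0, hsumQ], Fin.forall_fin_two.2 ⟨hQ, hj₀⟩,
        Or.inr (Or.inr (Or.inr (Fin.forall_fin_two.2 ⟨?_, ?_⟩)))⟩ <;>
      (apply modEq_of_eq_or; simp; try omega)
    by_cases h1 : v = 6 * h + 3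
    · refine ⟨![2 * h, 2 * h - 2], ?_, Fin.forall_fin_two.2 ⟨by simp, by simp⟩,
        Or.inr (Or.inr (Or.inl (Fin.forall_fin_two.2 ⟨?_, ?_⟩)))⟩
      · rw [sum_eq, lowTwo, highTwo]
        split_ifs <;> omega
      all_goals (apply modEq_of_eq_or; simp; try omega)
    obtain ⟨i, j, hi, hj, hsum, rfl | hcol⟩ := isLineSumTwo (by omega) hv (by omega) h0 h1
    · exact ⟨![i, i], by rw [sum_eq, hsum], Fin.forall_fin_two.2 ⟨hi, hi⟩,
        Or.inl ⟨i, Fin.forall_fin_two.2 ⟨rfl, rfl⟩⟩⟩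
    · refine ⟨![i, j], by rw [sum_eq, hsum], Fin.forall_fin_two.2 ⟨hi, hj⟩,
        Or.inr (Or.inl ⟨i, Fin.forall_fin_two.2 ⟨?_, ?_⟩⟩)⟩ <;>
      (apply modEq_of_eq_or; simp; try omega)

/-- A filling whose `k`-th transversal holds the values `nk, …, nk + n - 1`, so that it is given by
permutations `g k` of `0, …, n - 1`. -/
lemma hasFilling_of_stacked {n d : ℕ} [NeZero n] (g : Fin d → ℕ → ℕ) (P Q t a : ℕ)
    (ht : 3 * t ≡ 2 [MOD n])
    (hlt : ∀ k, ∀ j < n, g k j < n)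
    (hinj : ∀ k, ∀ i < n, ∀ j < n, g k i = g k j → i = j)
    (hwin : ∀ v, a ≤ v → v ≤ a + 2 * n + 1 → ∃ p : Fin d → ℕ, ∑ k, g k (p k) = v ∧
      (∀ k, p k < n) ∧
      ((∃ x, ∀ k, p k = x) ∨ (∃ y, ∀ k, p k + k ≡ y [MOD n]) ∨
        (∀ k, p k + 2 * k ≡ P [MOD n]) ∨ ∀ k, p k + t * k ≡ Q [MOD n])) :
    HasFilling n d := by
  refine hasFilling_of_nat (fun k x => n * k + g k x) P Q t (∑ k : Fin d, n * (k : ℕ) + a) ht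
    ?_ ?_ ?_
  · intro k j hj
    calc n * k + g k j < n * k + n := by have := hlt k j hj; omega
      _ = n * (k + 1) := by ring
      _ ≤ n * d := Nat.mul_le_mul_left n k.2
  · intro k l i hi j hj h
    have hi' := hlt k i hi
    have hj' := hlt l j hj
    have hkl : (k : ℕ) = l := by
      have h₁ : (n * k + g k i) / n = k := by
        rw [Nat.mul_add_div (by omega), Nat.div_eq_of_lt hi', add_zero]
      have h₂ : (n * l + g l j) / n = l := by
        rw [Nat.mul_add_div (by omega), Nat.div_eq_of_lt hj', add_zero]
      rw [← h₁, ← h₂, h]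
    obtain rfl := Fin.ext hkl
    exact ⟨rfl, hinj k i hi j hj (by omega)⟩
  · intro v hv hv'
    obtain ⟨p, hp, h⟩ := hwin (v - ∑ k : Fin d, n * (k : ℕ)) (by omega) (by omega)
    refine ⟨p, ?_, h⟩
    rw [Finset.sum_add_distrib, hp]
    omega

/-! ### Three transversals -/

/-- The anchoring permutation of the filling for `d = 3`, where `n = 2h + 1`. The other two
transversals, `upThree` and `downThree`, add up along each row and each column to one of only two
values, which differ by `n`. The larger one occurs in the rows `1, …, h + 1` and in the columns
`3, …, h + 2`, and there the deviation of the sum from its mean `3h` is `anchorThree` in a row and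
`anchorThree + 1` in a column; elsewhere it is less by `n`. The values are arranged so that
these deviations are all different. -/
def anchorThree (h x : ℕ) : ℕ :=
  if x = 0 then 1 else if x = 1 then 3 else if x ≤ h + 1 then 2 * x - 2
  else if x = h + 2 then 0 else 2 * x - 2 * h - 1

/-- The permutation `x ↦ x + h - 1` modulo `n = 2h + 1`; see `anchorThree`. -/
def upThree (h x : ℕ) : ℕ := if x ≤ h + 1 then x + h - 1 else x - h - 2

/-- The permutation `x ↦ -x` modulo `n = 2h + 1`; see `anchorThree`. -/
def downThree (h x : ℕ) : ℕ := if x = 0 then 0 else 2 * h + 1 - x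

/-- `v` is a row sum or a column sum of the filling for `d = 3`. -/
def IsLineSumThree (h v : ℕ) : Prop :=
  ∃ i j l, i < 2 * h + 1 ∧ j < 2 * h + 1 ∧ l < 2 * h + 1 ∧
    anchorThree h i + upThree h j + downThree h l = v ∧
    (i = j ∧ i = l ∨
      (i = j + 1 ∨ i + (2 * h + 1) = j + 1) ∧ (i = l + 2 ∨ i + (2 * h + 1) = l + 2))

/-- Rows and columns realize every sum in the window but two: the mean `3h`, and the maximum
`5h + 2`. These are left to the diagonals. -/
lemma isLineSumThree {h v : ℕ} (hh : 5 ≤ h) (hv : h - 1 ≤ v) (hv' : v ≤ 5 * h + 2)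
    (h0 : v ≠ 3 * h) (h1 : v ≠ 5 * h + 2) : IsLineSumThree h v := by
  have row : ∀ i, i < 2 * h + 1 → anchorThree h i + upThree h i + downThree h i = v →
      IsLineSumThree h v :=
    fun i hi hv => ⟨i, i, i, hi, hi, hi, hv, Or.inl ⟨rfl, rfl⟩⟩
  have col : ∀ i, i < 2 * h - 1 →
      anchorThree h (i + 2) + upThree h (i + 1) + downThree h i = v →
      IsLineSumThree h v :=
    fun i hi hv => ⟨i + 2, i + 1, i, by omega, by omega, by omega, hv,
      Or.inr ⟨Or.inl rfl, Or.inl rfl⟩⟩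
  unfold anchorThree upThree downThree at row col
  obtain ⟨r, hr | hr⟩ := Nat.even_or_odd' (v + 1 - h)
  · rcases (by omega : r = 0 ∨ r = 1 ∨ r = 2 ∨ (3 ≤ r ∧ r ≤ h) ∨ r = h + 1 ∨ r = h + 2 ∨
      (h + 3 ≤ r ∧ r ≤ 2 * h + 1)) with hc | hc | hc | hc | hc | hc | hc
    · exact row (h + 2) (by omega) (by split_ifs <;> first | omega | contradiction)
    · refine ⟨0, 2 * h, 2 * h - 1, by omega, by omega, by omega, ?_, by omega⟩
      unfold anchorThree upThree downThree
      split_ifs <;> omega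
    · refine ⟨1, 0, 2 * h, by omega, by omega, by omega, ?_, by omega⟩
      unfold anchorThree upThree downThree
      split_ifs <;> first | omega | contradiction
    · exact col (h - 2 + r) (by omega) (by split_ifs <;> first | omega | contradiction)
    · exact col h (by omega) (by split_ifs <;> first | omega | contradiction)
    · exact row 1 (by omega) (by split_ifs <;> first | omega | contradiction)
    · exact col (r - h - 2) (by omega) (by split_ifs <;> first | omega | contradiction)
  · rcases (by omega : r = 0 ∨ r = 1 ∨ (2 ≤ r ∧ r < h) ∨ (h < r ∧ r ≤ 2 * h)) with
      hc | hc | hc | hc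
    · exact row 0 (by omega) (by split_ifs <;> omega)
    · exact col 0 (by omega) (by split_ifs <;> first | omega | contradiction)
    · exact row (h + 1 + r) (by omega) (by split_ifs <;> omega)
    · exact row (r - h + 1) (by omega) (by split_ifs <;> first | omega | contradiction)

/-- An antidiagonal can be placed so that its sum is the mean `3h`. -/
lemma exists_antidiag_three {h m t : ℕ} (hh : 5 ≤ h)
    (hmt : 2 * h + 1 = 6 * m + 1 ∧ t = 2 * m + 1 ∨ 2 * h + 1 = 6 * m + 5 ∧ t = 4 * m + 4) :
    ∃ i j l, i < 2 * h + 1 ∧ j < 2 * h + 1 ∧ l < 2 * h + 1 ∧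
      anchorThree h i + upThree h j + downThree h l = 3 * h ∧
      (j + t = i ∨ j + t = i + (2 * h + 1)) ∧ (l + t = j ∨ l + t = j + (2 * h + 1)) := by
  unfold anchorThree upThree downThree
  rcases hmt with ⟨h₁, rfl⟩ | ⟨h₁, rfl⟩
  · refine ⟨2 * m + 1, 0, 4 * m, by omega, by omega, by omega, ?_, by omega, by omega⟩
    split_ifs <;> first | omega | contradiction
  -- The odd value `2m + 1` of `anchorThree` sits in row `4m + 3`, except that `3` sits in row `1`.
  · rcases (by omega : m = 1 ∨ 2 ≤ m) with rfl | hm2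
    · refine ⟨1, 4, 7, by omega, by omega, by omega, ?_, by omega, by omega⟩
      split_ifs <;> first | omega | contradiction
    · refine ⟨4 * m + 3, 6 * m + 4, 2 * m, by omega, by omega, by omega, ?_, by omega, by omega⟩
      split_ifs <;> first | omega | contradiction

lemma forall_fin_three {R : Fin 3 → Prop} (h0 : R 0) (h1 : R 1) (h2 : R 2) : ∀ k, R k := by
  intro k
  fin_cases k <;> assumption

theorem hasFilling_three {n m : ℕ} (hn : 11 ≤ n) (hm : n = 6 * m + 1 ∨ n = 6 * m + 5) :
    HasFilling n 3 := by
  obtain ⟨h, rfl⟩ : ∃ h, n = 2 * h + 1 := ⟨n / 2, by omega⟩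
  obtain ⟨t, ht, hmt⟩ := exists_two_thirds hm
  obtain ⟨Q, j₀, l₀, hQ, hj₀, hl₀, hsumQ, hQj, hjl⟩ := exists_antidiag_three (by omega) hmt
  refine hasFilling_of_stacked ![anchorThree h, upThree h, downThree h] (h + 1) Q t (h - 1) ht
    (forall_fin_three ?_ ?_ ?_) (forall_fin_three ?_ ?_ ?_) ?_
  · intro i hi
    simp only [Matrix.cons_val, anchorThree]
    split_ifs <;> omega
  · intro i hi
    simp only [Matrix.cons_val, upThree]
    split_ifs <;> omega
  · intro i hi
    simp only [Matrix.cons_val, downThree]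
    split_ifs <;> omega
  · intro i hi j hj hij
    simp only [Matrix.cons_val, anchorThree] at hij
    split_ifs at hij <;> omega
  · intro i hi j hj hij
    simp only [Matrix.cons_val, upThree] at hij
    split_ifs at hij <;> omega
  · intro i hi j hj hij
    simp only [Matrix.cons_val, downThree] at hij
    split_ifs at hij <;> omega
  · intro v hv hv'
    have sum_eq (i j l : ℕ) : ∑ k, (![anchorThree h, upThree h, downThree h] : Fin 3 → ℕ → ℕ) k
        ((![i, j, l] : Fin 3 → ℕ) k) = anchorThree h i + upThree h j + downThree h l := by
      simp [Fin.sum_univ_three]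
    by_cases h0 : v = 3 * h
    · refine ⟨![Q, j₀, l₀], by rw [sum_eq, h0, hsumQ], forall_fin_three hQ hj₀ hl₀,
        Or.inr (Or.inr (Or.inr (forall_fin_three ?_ ?_ ?_)))⟩ <;>
      (apply modEq_of_eq_or; simp; try omega)
    · by_cases h1 : v = 5 * h + 2
      · refine ⟨![h + 1, h - 1, h - 3], ?_, forall_fin_three (by simp; omega) (by simp; omega)
          (by simp; omega), Or.inr (Or.inr (Or.inl (forall_fin_three ?_ ?_ ?_)))⟩
        · rw [sum_eq, anchorThree, upThree, downThree]
          split_ifs <;> first | omega | contradiction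
        all_goals (apply modEq_of_eq_or; simp; try omega)
      · obtain ⟨i, j, l, hi, hj, hl, hsum, ⟨rfl, rfl⟩ | hcol⟩ :=
          isLineSumThree (by omega) hv (by omega) h0 h1
        · exact ⟨![i, i, i], by rw [sum_eq, hsum], forall_fin_three hi hi hi,
            Or.inl ⟨i, forall_fin_three rfl rfl rfl⟩⟩
        · refine ⟨![i, j, l], by rw [sum_eq, hsum], forall_fin_three hi hj hl,
            Or.inr (Or.inl ⟨i, forall_fin_three ?_ ?_ ?_⟩)⟩ <;>
          (apply modEq_of_eq_or; simp; try omega)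

/-! ### Four transversals -/

/-- The permutation `x ↦ h + 1 - x/2` modulo `n = 2h + 1`, on the second transversal of the
filling for `d = 4`. The first transversal `x ↦ x` and the third one, `downFour`, add up in rows
and in columns to only two values, which differ by `n`. The second and the fourth one,
`slantFour'`, both have slope `-1/2`; up to a few exceptions their sum falls by two from one row or
column to the next but one, and lies below the mean on one parity class and above it on the
other. -/
def slantFour (h x : ℕ) : ℕ :=
  if x % 2 = 0 then h + 1 - x / 2 else if x = 1 then 0 else 2 * h + 1 - x / 2

/-- The permutation `x ↦ 2 - x` modulo `n = 2h + 1`; see `slantFour`. -/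
def downFour (h x : ℕ) : ℕ := if x ≤ 2 then 2 - x else 2 * h + 3 - x

/-- The permutation `x ↦ h - 2 - x/2` modulo `n = 2h + 1`; see `slantFour`. -/
def slantFour' (h x : ℕ) : ℕ :=
  if x % 2 = 0 then (if x + 4 ≤ 2 * h then h - 2 - x / 2 else 3 * h - 1 - x / 2)
  else 2 * h - 2 - x / 2

/-- The sum of four cells, one on each transversal of the filling for `d = 4`. -/
def sumFour (h i j l q : ℕ) : ℕ := i + slantFour h j + downFour h l + slantFour' h q

/-- `v` is a row sum or a column sum of the filling for `d = 4`. -/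
def IsLineSumFour (h v : ℕ) : Prop :=
  ∃ i j l q, i < 2 * h + 1 ∧ j < 2 * h + 1 ∧ l < 2 * h + 1 ∧ q < 2 * h + 1 ∧
    sumFour h i j l q = v ∧
    (i = j ∧ i = l ∧ i = q ∨
      (i = j + 1 ∨ i + (2 * h + 1) = j + 1) ∧ (i = l + 2 ∨ i + (2 * h + 1) = l + 2) ∧
        (i = q + 3 ∨ i + (2 * h + 1) = q + 3))

/-- Rows and columns realize every sum in the window but two: the mean `4h`, and the maximum
`6h + 2`. These are left to the diagonals. -/
lemma isLineSumFour {h v : ℕ} (hh : 5 ≤ h) (hv : 2 * h - 1 ≤ v) (hv' : v ≤ 6 * h + 2)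
    (h0 : v ≠ 4 * h) (h1 : v ≠ 6 * h + 2) : IsLineSumFour h v := by
  have row : ∀ i, i < 2 * h + 1 → sumFour h i i i i = v → IsLineSumFour h v :=
    fun i hi hv => ⟨i, i, i, i, hi, hi, hi, hi, hv, Or.inl ⟨rfl, rfl, rfl⟩⟩
  have col : ∀ i, i + 3 < 2 * h + 1 → sumFour h (i + 3) (i + 2) (i + 1) i = v →
      IsLineSumFour h v :=
    fun i hi hv => ⟨i + 3, i + 2, i + 1, i, by omega, by omega, by omega, by omega, hv,
      Or.inr ⟨Or.inl rfl, Or.inl rfl, Or.inl rfl⟩⟩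
  unfold sumFour slantFour slantFour' downFour at row col
  rcases (by omega : v = 2 * h - 1 ∨ 2 * h ≤ v) with hc | hge
  · exact row 2 (by omega) (by split_ifs <;> omega)
  obtain ⟨r, hr | hr⟩ := Nat.even_or_odd' (v - 2 * h)
  · rcases (by omega : r = 0 ∨ r = 1 ∨ r = 2 ∨ (3 ≤ r ∧ r < h) ∨ r = h + 1 ∨
      (h + 2 ≤ r ∧ r ≤ 2 * h)) with hc | hc | hc | hc | hc | hc
    · exact row 1 (by omega) (by split_ifs <;> first | omega | contradiction)
    · exact col 0 (by omega) (by split_ifs <;> omega)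
    · refine ⟨1, 0, 2 * h, 2 * h - 1, by omega, by omega, by omega, by omega, ?_, by omega⟩
      unfold sumFour slantFour slantFour' downFour
      split_ifs <;> omega
    · exact row (2 * h + 2 - 2 * r) (by omega) (by split_ifs <;> omega)
    · exact col 1 (by omega) (by split_ifs <;> first | omega | contradiction)
    · exact row (4 * h + 3 - 2 * r) (by omega) (by split_ifs <;> omega)
  · rcases (by omega : r = 0 ∨ r = 1 ∨ r = 2 ∨ (3 ≤ r ∧ r ≤ h) ∨ r = h + 1 ∨ r = h + 2 ∨
      (h + 3 ≤ r ∧ r ≤ 2 * h)) with hc | hc | hc | hc | hc | hc | hc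
    · exact row 0 (by omega) (by split_ifs <;> omega)
    · refine ⟨2, 1, 0, 2 * h, by omega, by omega, by omega, by omega, ?_, by omega⟩
      unfold sumFour slantFour slantFour' downFour
      split_ifs <;> first | omega | contradiction
    · refine ⟨0, 2 * h, 2 * h - 1, 2 * h - 2, by omega, by omega, by omega, by omega, ?_,
        by omega⟩
      unfold sumFour slantFour slantFour' downFour
      split_ifs <;> omega
    · exact col (2 * h + 2 - 2 * r) (by omega) (by split_ifs <;> omega)
    · exact row (2 * h) (by omega) (by split_ifs <;> omega)
    · exact row (2 * h - 2) (by omega) (by split_ifs <;> omega)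
    · exact col (4 * h + 3 - 2 * r) (by omega) (by split_ifs <;> omega)

/-- The diagonals can be placed so that one has the mean sum `4h` and the other the maximum
`6h + 2`; which one has the maximum depends on `n`. -/
lemma exists_diag_four {h m t : ℕ} (hh : 5 ≤ h)
    (hmt : 2 * h + 1 = 6 * m + 1 ∧ t = 2 * m + 1 ∨ 2 * h + 1 = 6 * m + 5 ∧ t = 4 * m + 4) :
    ∃ P i j l q, 6 ≤ P ∧ P < 2 * h + 1 ∧
      i < 2 * h + 1 ∧ j < 2 * h + 1 ∧ l < 2 * h + 1 ∧ q < 2 * h + 1 ∧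
      (j + t = i ∨ j + t = i + (2 * h + 1)) ∧ (l + t = j ∨ l + t = j + (2 * h + 1)) ∧
      (q + t = l ∨ q + t = l + (2 * h + 1)) ∧
      (sumFour h P (P - 2) (P - 4) (P - 6) = 6 * h + 2 ∧ sumFour h i j l q = 4 * h ∨
        sumFour h P (P - 2) (P - 4) (P - 6) = 4 * h ∧ sumFour h i j l q = 6 * h + 2) := by
  rcases hmt with ⟨h₁, rfl⟩ | ⟨h₁, rfl⟩
  · refine ⟨9, 2 * m + 5, 4, 4 * m + 4, 2 * m + 3, by omega, by omega, by omega, by omega,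
      by omega, by omega, by omega, by omega, by omega, Or.inl ⟨?_, ?_⟩⟩ <;>
    unfold sumFour slantFour slantFour' downFour <;>
    split_ifs <;> first | omega | contradiction
  · rcases (by omega : m = 1 ∨ 2 ≤ m) with rfl | hm2
    -- For `n = 11` the antidiagonal that serves all larger `n ≡ 5 [MOD 6]` would start at row `11`.
    · obtain rfl : h = 5 := by omega
      exact ⟨9, 1, 4, 7, 10, by decide⟩
    · refine ⟨10, 4 * m + 7, 3, 2 * m + 4, 4 * m + 5, by omega, by omega, by omega, by omega,
        by omega, by omega, by omega, by omega, by omega, Or.inr ⟨?_, ?_⟩⟩ <;>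
      unfold sumFour slantFour slantFour' downFour <;>
      split_ifs <;> first | omega | contradiction

lemma forall_fin_four {R : Fin 4 → Prop} (h0 : R 0) (h1 : R 1) (h2 : R 2) (h3 : R 3) :
    ∀ k, R k := by
  intro k
  fin_cases k <;> assumption

theorem hasFilling_four {n m : ℕ} (hn : 11 ≤ n) (hm : n = 6 * m + 1 ∨ n = 6 * m + 5) :
    HasFilling n 4 := by
  obtain ⟨h, rfl⟩ : ∃ h, n = 2 * h + 1 := ⟨n / 2, by omega⟩
  obtain ⟨t, ht, hmt⟩ := exists_two_thirds hm
  obtain ⟨P, i₀, j₀, l₀, q₀, hP6, hP, hi₀, hj₀, hl₀, hq₀, hij, hjl, hlq, hsum⟩ :=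
    exists_diag_four (by omega) hmt
  refine hasFilling_of_stacked ![id, slantFour h, downFour h, slantFour' h] P i₀ t (2 * h - 1) ht
    (forall_fin_four ?_ ?_ ?_ ?_) (forall_fin_four ?_ ?_ ?_ ?_) ?_
  · intro i hi
    exact hi
  · intro i hi
    simp only [Matrix.cons_val, slantFour]
    split_ifs <;> omega
  · intro i hi
    simp only [Matrix.cons_val, downFour]
    split_ifs <;> omega
  · intro i hi
    simp only [Matrix.cons_val, slantFour']
    split_ifs <;> omega
  · intro i hi j hj hij
    exact hij
  · intro i hi j hj hij
    simp only [Matrix.cons_val, slantFour] at hij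
    split_ifs at hij <;> omega
  · intro i hi j hj hij
    simp only [Matrix.cons_val, downFour] at hij
    split_ifs at hij <;> omega
  · intro i hi j hj hij
    simp only [Matrix.cons_val, slantFour'] at hij
    split_ifs at hij <;> omega
  · intro v hv hv'
    have sum_eq (i j l q : ℕ) :
        ∑ k, (![id, slantFour h, downFour h, slantFour' h] : Fin 4 → ℕ → ℕ) k
          ((![i, j, l, q] : Fin 4 → ℕ) k) = sumFour h i j l q := by
      simp [Fin.sum_univ_four, sumFour]
    by_cases hdiag : sumFour h P (P - 2) (P - 4) (P - 6) = v
    · refine ⟨![P, P - 2, P - 4, P - 6], by rw [sum_eq, hdiag], forall_fin_four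
        (by simpa using hP) (by simp; omega) (by simp; omega) (by simp; omega),
        Or.inr (Or.inr (Or.inl (forall_fin_four ?_ ?_ ?_ ?_)))⟩ <;>
      (apply modEq_of_eq_or; simp; try omega)
    by_cases hanti : sumFour h i₀ j₀ l₀ q₀ = v
    · refine ⟨![i₀, j₀, l₀, q₀], by rw [sum_eq, hanti], forall_fin_four hi₀ hj₀ hl₀ hq₀,
        Or.inr (Or.inr (Or.inr (forall_fin_four ?_ ?_ ?_ ?_)))⟩ <;>
      (apply modEq_of_eq_or; simp; try omega)
    obtain ⟨i, j, l, q, hi, hj, hl, hq, hsum', ⟨rfl, rfl, rfl⟩ | hcol⟩ :=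
      isLineSumFour (v := v) (h := h) (by omega) hv (by omega) (by omega) (by omega)
    · exact ⟨![i, i, i, i], by rw [sum_eq, hsum'], forall_fin_four hi hi hi hi,
        Or.inl ⟨i, forall_fin_four rfl rfl rfl rfl⟩⟩
    · refine ⟨![i, j, l, q], by rw [sum_eq, hsum'], forall_fin_four hi hj hl hq,
        Or.inr (Or.inl ⟨i, forall_fin_four ?_ ?_ ?_ ?_⟩)⟩ <;>
      (apply modEq_of_eq_or; simp; try omega)

/-! ### Existence for all densities -/

/-- The blocks of three transversals reach every density from `2`, `3` and `4`. For `n ≤ 7` some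
base fillings or blocks break down, and explicit tables replace them. -/
theorem hasFilling {n m d : ℕ} (hn : 5 ≤ n) (hm : n = 6 * m + 1 ∨ n = 6 * m + 5)
    (hd : 2 ≤ d) (hdn : d < n) : HasFilling n d := by
  rcases (by omega : n = 5 ∨ n = 7 ∨ 11 ≤ n) with rfl | rfl | hn'
  · interval_cases d
    · exact hasFilling_two le_rfl hm
    · exact hasFilling_five_three
    · exact hasFilling_five_four
  · interval_cases d
    · exact hasFilling_two hn hm
    · exact hasFilling_seven_three
    · exact hasFilling_seven_four
    · exact hasFilling_seven_five
    · exact hasFilling_seven_six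
  · clear hdn
    induction d using Nat.strong_induction_on with
    | _ d ih =>
      rcases (by omega : d = 2 ∨ d = 3 ∨ d = 4 ∨ 5 ≤ d) with rfl | rfl | rfl | hd5
      · exact hasFilling_two hn hm
      · exact hasFilling_three hn' hm
      · exact hasFilling_four hn' hm
      · obtain ⟨c, rfl⟩ : ∃ c, d = c + 3 := ⟨d - 3, by omega⟩
        exact (ih c (by omega) (by omega)).add_three (by omega) hm

theorem theorem1p3 (n : ℕ) (hn : 5 ≤ n) (hmod : n ≡ 1 [MOD 6] ∨ n ≡ 5 [MOD 6]) (d : ℕ) :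
    (∃ A : Matrix (Fin n) (Fin n) ℕ, IsRegularSAMS n d A) ↔ 2 ≤ d ∧ d ≤ n - 1 := by
  have hm : n = 6 * (n / 6) + 1 ∨ n = 6 * (n / 6) + 5 := by
    simp only [Nat.ModEq] at hmod
    omega
  constructor
  · rintro ⟨A, hA⟩
    exact ⟨two_le_of_isRegularSAMS hA, Nat.le_pred_of_lt hA.density_lt⟩
  · rintro ⟨hd, hdn⟩
    refine exists_isRegularSAMS_of_hasFilling (by omega) ?_ (by omega) (by omega)
      (hasFilling hn hm hd (by omega))
    rw [Nat.coprime_two_right, Nat.odd_iff]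
    omega
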